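/- **Theorem (Modeling of the Averaged Stochastic Gradients).** Let $s_0,s_1,s_2,\dots$ be i.i.d. random data with values in a measurable space, let $l(\boldsymbol w;s)$ be a real loss with $\boldsymbol w\in\mathbb R^d$, and fix a weight $\boldsymbol w$ at which $l(\cdot\,;s)$ is differentiable for every $s$ and $s\mapsto\nabla_{\boldsymbol w} l(\boldsymbol w;s)$ is measurable. Fix a clipping threshold $C>0$ and put $$\boldsymbol g_j=\nabla_{\boldsymbol w} l(\boldsymbol w;s_j),\qquad \tilde{\boldsymbol g}_j=\frac{\boldsymbol g_j}{\max\{1,\|\boldsymbol g_j\|_2/C\}},\qquad \tilde{\boldsymbol g}^{(B)}=\frac1B\sum_{j=0}^{B-1}\tilde{\boldsymbol g}_j .$$ Fix a coordinate $z\in\{1,\dots,d\}$, let $\tilde{\boldsymbol g}_{jz}$ and $\tilde{\boldsymbol g}^{(B)}_z$ be the $z$-th coordinates, let $m=\mathbb E(\tilde{\boldsymbol g}_{0z})$ and $v=\mathrm{var}(\tilde{\boldsymbol g}_{0z})$, and suppose $v>0$. Then: 1. $\tilde{\boldsymbol g}^{(B)}_z=\frac1B\sum_{j=0}^{B-1}\tilde{\boldsymbol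 g}_{jz}$, where the vectors $\tilde{\boldsymbol g}_j$ are independent and identically distributed, and each $\tilde{\boldsymbol g}_{jz}$ is square-integrable with mean $m$ and variance $v$. 2. As $B\to\infty$, $\dfrac{\tilde{\boldsymbol g}^{(B)}_z-m}{\sqrt{v/B}}$ converges in distribution to the standard Gaussian $\mathcal N(0,1)$; in particular, for every $X\in\mathbb R$, $$\lim_{B\to\infty}\Pr\left(\frac{\tilde{\boldsymbol g}^{(B)}_z-m}{\sqrt{v/B}}\le X\right)=\int_{-\infty}^X\frac1{\sqrt{2\pi}}e^{-x^2/2}\,dx .$$ 3. The law of $\tilde{\boldsymbol g}^{(B)}_z$ is asymptotically the one with density $$f_B(x)=\sqrt{\frac{B}{2\pi v}}\exp\left(-\frac{B(x-m)^2}{2v}\right),$$ in the sense that $\displaystyle\lim_{B\to\infty}\sup_{x\in\mathbb R}\left|\Pr\left(\tilde{\boldsymbol g}^{(B)}_z\le x\right)-\int_{-\infty}^x f_B(y)\,dy\right|=0 .$ -/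

import Mathlib

open MeasureTheory ProbabilityTheory Filter Topology

noncomputable section

/-- Clipping of a gradient at threshold `C`: `g / max {1, ‖g‖ / C}` with the Euclidean norm. -/
def clip {d : ℕ} (C : ℝ) (g : EuclideanSpace ℝ (Fin d)) : EuclideanSpace ℝ (Fin d) :=
  (max 1 (‖g‖ / C))⁻¹ • g

/-- The per-sample gradient `∇_w l(w; x)` of the loss at the weight `w` and the datum `x`. -/
def sampleGrad {d : ℕ} {D : Type*} (loss : EuclideanSpace ℝ (Fin d) → D → ℝ)
    (w : EuclideanSpace ℝ (Fin d)) (x : D) : EuclideanSpace ℝ (Fin d) :=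
  gradient (fun v => loss v x) w

/-- The clipped per-sample gradient. -/
def clippedGrad {d : ℕ} {D : Type*} (loss : EuclideanSpace ℝ (Fin d) → D → ℝ) (C : ℝ)
    (w : EuclideanSpace ℝ (Fin d)) (x : D) : EuclideanSpace ℝ (Fin d) :=
  clip C (sampleGrad loss w x)

/-- The batch average of the clipped gradients of the first `B` data `x 0, …, x (B - 1)`. -/
def batchGrad {d : ℕ} {D : Type*} (loss : EuclideanSpace ℝ (Fin d) → D → ℝ) (C : ℝ)
    (w : EuclideanSpace ℝ (Fin d)) (B : ℕ) (x : ℕ → D) : EuclideanSpace ℝ (Fin d) :=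
  (1 / (B : ℝ)) • ∑ j ∈ Finset.range B, clippedGrad loss C w (x j)

/-- The Gaussian density with mean `m` and variance `v / B`. -/
def limitDensity (m v : ℝ) (B : ℕ) (x : ℝ) : ℝ :=
  Real.sqrt (B / (2 * Real.pi * v)) * Real.exp (-(B * (x - m) ^ 2 / (2 * v)))

end

open scoped NNReal

/-! Clipping bounds every coordinate by `C`, so the i.i.d. coordinates are square-integrable
whatever the law of the data, and the classical central limit theorem gives convergence to the
standard Gaussian. That limit has no atoms, hence distribution functions converge at every point,
and by Pólya's theorem uniformly. Uniformity is what the last claim needs: undoing the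
standardization turns a fixed `x` into the point `(x - m) / √(v / B)`, which moves with `B`. -/

/-- **Pólya's theorem**: monotone functions with values in `[0, 1]` that converge pointwise to a
continuous distribution function converge uniformly. -/
theorem tendstoUniformly_of_monotone_of_tendsto {ι : Type*} {l : Filter ι} {F : ι → ℝ → ℝ}
    {G : ℝ → ℝ} (hF : ∀ i, Monotone (F i)) (hF0 : ∀ i x, 0 ≤ F i x) (hF1 : ∀ i x, F i x ≤ 1)
    (hG : Monotone G) (hGc : Continuous G) (hGbot : Tendsto G atBot (𝓝 0))
    (hGtop : Tendsto G atTop (𝓝 1)) (h : ∀ x, Tendsto (fun i => F i x) l (𝓝 (G x))) :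
    TendstoUniformly F G l := by
  have hG0 : ∀ x, 0 ≤ G x := hG.le_of_tendsto hGbot
  have hG1 : ∀ x, G x ≤ 1 := hG.ge_of_tendsto hGtop
  have near : ∀ x ε, 0 < ε → ∀ᶠ i in l, |F i x - G x| < ε := fun x ε hε =>
    Metric.tendsto_nhds.1 (h x) ε hε
  have hloc : TendstoLocallyUniformly F G l := by
    rw [Metric.tendstoLocallyUniformly_iff]
    intro ε hε a
    -- Monotonicity squeezes both functions between their values at `a ± δ / 2`. There `G` is within
    -- `ε / 4` of `G a` and, eventually, `F i` is within `ε / 4` of `G`.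
    obtain ⟨δ, hδ, hGδ⟩ := Metric.continuous_iff.1 hGc a (ε / 4) (by positivity)
    have hp := abs_lt.1 (hGδ (a - δ / 2) (by rw [Real.dist_eq, abs_lt]; constructor <;> linarith))
    have hq := abs_lt.1 (hGδ (a + δ / 2) (by rw [Real.dist_eq, abs_lt]; constructor <;> linarith))
    refine ⟨Set.Icc (a - δ / 2) (a + δ / 2), Icc_mem_nhds (by linarith) (by linarith), ?_⟩
    filter_upwards [near (a - δ / 2) (ε / 4) (by positivity),
      near (a + δ / 2) (ε / 4) (by positivity)] with i hi hi' x hx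
    rw [abs_lt] at hi hi'
    have h1 := hF i hx.1
    have h2 := hF i hx.2
    have h3 := hG hx.1
    have h4 := hG hx.2
    rw [Real.dist_eq, abs_lt]
    constructor <;> linarith
  rw [Metric.tendstoUniformly_iff]
  intro ε hε
  -- Outside a compact interval both functions are within `ε` of 0 (left) or of 1 (right), so they
  -- are close to each other.
  obtain ⟨p, hp⟩ := (hGbot.eventually (gt_mem_nhds (half_pos hε))).exists
  obtain ⟨q, hq⟩ := (hGtop.eventually
    (lt_mem_nhds (show 1 - ε / 2 < 1 by linarith))).exists
  have hmid := Metric.tendstoUniformlyOn_iff.1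
    ((tendstoLocallyUniformlyOn_iff_tendstoUniformlyOn_of_compact isCompact_Icc).1
      (hloc.tendstoLocallyUniformlyOn (s := Set.Icc p q))) ε hε
  filter_upwards [hmid, near p (ε / 2) (by positivity), near q (ε / 2) (by positivity)]
    with i hi hip hiq x
  rw [abs_lt] at hip hiq
  by_cases hxp : x < p
  · have h1 := hF i hxp.le
    have h2 := hG hxp.le
    rw [Real.dist_eq, abs_lt]
    constructor <;> linarith [hF0 i x, hG0 x]
  by_cases hxq : q < x
  · have h1 := hF i hxq.le
    have h2 := hG hxq.le
    rw [Real.dist_eq, abs_lt]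
    constructor <;> linarith [hF1 i x, hG1 x]
  exact hi x ⟨not_lt.1 hxp, not_lt.1 hxq⟩

/-- A distribution function is right-continuous, and its jump at a point is the mass of that point.
-/
theorem continuous_cdf_of_nullSingletonClass (μ : Measure ℝ) [IsProbabilityMeasure μ]
    [NullSingletonClass μ] : Continuous (cdf μ) := by
  refine continuous_iff_continuousAt.2 fun x => ?_
  rw [(monotone_cdf μ).continuousAt_iff_leftLim_eq_rightLim, StieltjesFunction.rightLim_eq]
  have h : (cdf μ).measure {x} = 0 := by rw [measure_cdf]; exact measure_singleton x
  rw [StieltjesFunction.measure_singleton, ENNReal.ofReal_eq_zero] at h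
  exact le_antisymm ((monotone_cdf μ).leftLim_le le_rfl) (by linarith)

/-- Convergence in distribution gives convergence of the distribution functions, where the limit
has no atoms. -/
theorem tendsto_measureReal_le_of_tendstoInDistribution {Ω Ω' ι : Type*} [MeasurableSpace Ω]
    [MeasurableSpace Ω'] {P : Measure Ω} [IsProbabilityMeasure P] {P' : Measure Ω'}
    [IsProbabilityMeasure P'] {l : Filter ι} {X : ι → Ω → ℝ} {Z : Ω' → ℝ}
    (h : TendstoInDistribution X l Z (fun _ => P) P') [NullSingletonClass (P'.map Z)] (x : ℝ) :
    Tendsto (fun i => P.real {ω | X i ω ≤ x}) l (𝓝 ((P'.map Z).real (Set.Iic x))) := by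
  have := Measure.isProbabilityMeasure_map h.aemeasurable_limit
  -- Portmanteau: the frontier of the half-line is `{x}`, a null set for the limit law.
  have key := ProbabilityMeasure.tendsto_measure_of_null_frontier_of_tendsto' h.tendsto
    (E := Set.Iic x) (by
      rw [frontier_Iic, ProbabilityMeasure.coe_mk]; exact measure_singleton x)
  have := (ENNReal.tendsto_toReal (measure_ne_top (P'.map Z) (Set.Iic x))).comp key
  refine this.congr fun i => ?_
  simp only [Function.comp_apply, ProbabilityMeasure.coe_mk, measureReal_def]
  rw [Measure.map_apply_of_aemeasurable (h.forall_aemeasurable i) measurableSet_Iic]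
  rfl

theorem gaussianReal_real_eq_integral (μ : ℝ) {v : ℝ≥0} (hv : v ≠ 0) (s : Set ℝ) :
    (gaussianReal μ v).real s = ∫ x in s, gaussianPDFReal μ v x := by
  rw [measureReal_def, gaussianReal_apply_eq_integral _ hv,
    ENNReal.toReal_ofReal (integral_nonneg fun _ => gaussianPDFReal_nonneg _ _ _)]

theorem gaussianReal_real_Iic_standardize (m : ℝ) {σ : ℝ} (hσ : 0 < σ) (x : ℝ) :
    (gaussianReal m (σ ^ 2).toNNReal).real (Set.Iic x) =
      (gaussianReal 0 1).real (Set.Iic ((x - m) / σ)) := by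
  have h : gaussianReal m (σ ^ 2).toNNReal =
      ((gaussianReal 0 1).map (σ * ·)).map (· + m) := by
    rw [gaussianReal_map_const_mul, gaussianReal_map_add_const]
    congr 1
    · simp
    · ext; simp [sq_nonneg]
  rw [h, Measure.map_map (by fun_prop) (by fun_prop),
    map_measureReal_apply (by fun_prop) measurableSet_Iic]
  congr 1
  ext y
  simp [le_div_iff₀ hσ, le_sub_iff_add_le, mul_comm]

theorem limitDensity_eq_gaussianPDFReal (m : ℝ) {v : ℝ} (hv : 0 < v) {B : ℕ} (hB : 0 < B) :
    limitDensity m v B = gaussianPDFReal m (Real.sqrt (v / B) ^ 2).toNNReal := by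
  have hB' : (0 : ℝ) < B := by exact_mod_cast hB
  have hvB : 0 < v / B := by positivity
  ext x
  rw [limitDensity, gaussianPDFReal, Real.sq_sqrt hvB.le, Real.coe_toNNReal _ hvB.le,
    ← Real.sqrt_inv]
  congr 2 <;> field_simp

theorem norm_clip_le {d : ℕ} {C : ℝ} (hC : 0 < C) (g : EuclideanSpace ℝ (Fin d)) :
    ‖clip C g‖ ≤ C := by
  have h1 : 0 < max 1 (‖g‖ / C) := lt_max_of_lt_left one_pos
  rw [clip, norm_smul, Real.norm_eq_abs, abs_of_pos (inv_pos.2 h1), inv_mul_le_iff₀ h1,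
    ← div_le_iff₀ hC]
  exact le_max_right _ _

theorem measurable_clip {d : ℕ} (C : ℝ) :
    Measurable (clip C : EuclideanSpace ℝ (Fin d) → EuclideanSpace ℝ (Fin d)) := by
  unfold clip
  fun_prop

theorem batchGrad_apply {d : ℕ} {D : Type*} (loss : EuclideanSpace ℝ (Fin d) → D → ℝ) (C : ℝ)
    (w : EuclideanSpace ℝ (Fin d)) (B : ℕ) (x : ℕ → D) (z : Fin d) :
    batchGrad loss C w B x z =
      1 / (B : ℝ) * ∑ j ∈ Finset.range B, clippedGrad loss C w (x j) z := by
  simp [batchGrad]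

/-- The central limit theorem for the standardized average. -/
theorem tendstoInDistribution_average_standardize {Ω : Type*} [MeasurableSpace Ω] {P : Measure Ω}
    [IsProbabilityMeasure P] {X : ℕ → Ω → ℝ} (hX : MemLp (X 0) 2 P) (hvar : 0 < variance (X 0) P)
    (hindep : iIndepFun X P) (hident : ∀ i, IdentDistrib (X i) (X 0) P P) :
    TendstoInDistribution
      (fun (n : ℕ) ω => (1 / (n : ℝ) * ∑ k ∈ Finset.range n, X k ω - ∫ ω, X 0 ω ∂P) /
        Real.sqrt (variance (X 0) P / n))
      atTop (id : ℝ → ℝ) (fun _ => P) (gaussianReal 0 1) := by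
  set v := variance (X 0) P with hv
  set m := ∫ ω, X 0 ω ∂P with hm
  have hsv : 0 < Real.sqrt v := Real.sqrt_pos.2 hvar
  -- Realizing the limit `N(0, v)` as `√v * y` with `y` standard makes division by `√v` leave
  -- exactly `id`.
  have hY : HasLaw (fun y : ℝ => Real.sqrt v * y) (gaussianReal 0 v.toNNReal)
      (gaussianReal 0 1) := by
    refine ⟨by fun_prop, ?_⟩
    rw [gaussianReal_map_const_mul]
    congr 1
    · simp
    · ext; simp [Real.sq_sqrt hvar.le, hvar.le]
  have h := (tendstoInDistribution_inv_sqrt_mul_sum_sub hY hX hindep hident).continuous_comp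
    (g := fun y => y / Real.sqrt v) (by fun_prop)
  refine h.congr (fun n => Eventually.of_forall fun ω => ?_) (Eventually.of_forall fun y => ?_)
  -- For `n = 0` both sides vanish, since division by zero gives zero.
  · rcases Nat.eq_zero_or_pos n with rfl | hn
    · simp
    have hn' : (0 : ℝ) < n := by exact_mod_cast hn
    have hsn : 0 < Real.sqrt n := Real.sqrt_pos.2 hn'
    simp only [Function.comp_apply]
    rw [Real.sqrt_div hvar.le]
    field_simp
    rw [Real.sq_sqrt hn'.le]
  · simp [hsv.ne']

theorem mainTheorem8 {Ω D : Type*} [MeasurableSpace Ω] [MeasurableSpace D]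
    (P : Measure Ω) [IsProbabilityMeasure P] {d : ℕ}
    (loss : EuclideanSpace ℝ (Fin d) → D → ℝ) (w : EuclideanSpace ℝ (Fin d))
    (hdiff : ∀ x : D, DifferentiableAt ℝ (fun v => loss v x) w)
    (hmeas : Measurable (sampleGrad loss w))
    (C : ℝ) (hC : 0 < C)
    (s : ℕ → Ω → D) (hindep : iIndepFun s P) (hident : ∀ j, IdentDistrib (s j) (s 0) P P)
    (z : Fin d) (m v : ℝ)
    (hm : m = ∫ ω, clippedGrad loss C w (s 0 ω) z ∂P)
    (hv : v = variance (fun ω => clippedGrad loss C w (s 0 ω) z) P)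
    (hvpos : 0 < v) :
    -- the coordinate of the batch gradient is the average of the per-sample coordinates
    (∀ (B : ℕ) (ω : Ω), batchGrad loss C w B (fun j => s j ω) z =
      1 / (B : ℝ) * ∑ j ∈ Finset.range B, clippedGrad loss C w (s j ω) z) ∧
    -- the clipped per-sample gradients are i.i.d., with coordinate mean `m` and variance `v`
    iIndepFun (fun j ω => clippedGrad loss C w (s j ω)) P ∧
    (∀ j, IdentDistrib (fun ω => clippedGrad loss C w (s j ω))
      (fun ω => clippedGrad loss C w (s 0 ω)) P P) ∧
    (∀ j, MemLp (fun ω => clippedGrad loss C w (s j ω) z) 2 P ∧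
      ∫ ω, clippedGrad loss C w (s j ω) z ∂P = m ∧
      variance (fun ω => clippedGrad loss C w (s j ω) z) P = v) ∧
    -- convergence in distribution of the normalized average to the standard Gaussian
    TendstoInDistribution
      (fun (B : ℕ) ω =>
        (batchGrad loss C w B (fun j => s j ω) z - m) / Real.sqrt (v / (B : ℝ)))
      atTop (id : ℝ → ℝ) (fun _ => P) (gaussianReal 0 1) ∧
    -- the same through distribution functions
    (∀ X : ℝ, Tendsto
      (fun B : ℕ => P.real {ω |
        (batchGrad loss C w B (fun j => s j ω) z - m) / Real.sqrt (v / (B : ℝ)) ≤ X})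
      atTop
      (𝓝 (∫ x in Set.Iic X, 1 / Real.sqrt (2 * Real.pi) * Real.exp (-(x ^ 2 / 2))))) ∧
    -- the law of the average is asymptotically the one with density `limitDensity m v B`
    (∀ ε : ℝ, 0 < ε → ∀ᶠ B : ℕ in atTop, ∀ x : ℝ,
      |P.real {ω | batchGrad loss C w B (fun j => s j ω) z ≤ x} -
        ∫ y in Set.Iic x, limitDensity m v B y| < ε) := by
  have hmc : Measurable (clippedGrad loss C w) := (measurable_clip C).comp hmeas
  have hcoord : Measurable fun g : EuclideanSpace ℝ (Fin d) => g z := by fun_prop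
  have hid : ∀ j, IdentDistrib (fun ω => clippedGrad loss C w (s j ω))
      (fun ω => clippedGrad loss C w (s 0 ω)) P P := fun j => (hident j).comp hmc
  have hind : iIndepFun (fun j ω => clippedGrad loss C w (s j ω)) P :=
    hindep.comp (fun _ => clippedGrad loss C w) fun _ => hmc
  have hidz : ∀ j, IdentDistrib (fun ω => clippedGrad loss C w (s j ω) z)
      (fun ω => clippedGrad loss C w (s 0 ω) z) P P := fun j => (hid j).comp hcoord
  have hindz : iIndepFun (fun j ω => clippedGrad loss C w (s j ω) z) P :=
    hind.comp (fun _ g => g z) fun _ => hcoord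
  have hLp : ∀ j, MemLp (fun ω => clippedGrad loss C w (s j ω) z) 2 P := fun j =>
    MemLp.of_bound (hidz j).aemeasurable_fst.aestronglyMeasurable C
      (Eventually.of_forall fun ω => (PiLp.norm_apply_le _ z).trans (norm_clip_le hC _))
  have hclt : TendstoInDistribution
      (fun (B : ℕ) ω =>
        (batchGrad loss C w B (fun j => s j ω) z - m) / Real.sqrt (v / (B : ℝ)))
      atTop (id : ℝ → ℝ) (fun _ => P) (gaussianReal 0 1) := by
    simp only [batchGrad_apply, hm, hv]
    exact tendstoInDistribution_average_standardize (hLp 0) (hv ▸ hvpos) hindz hidz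
  have : NullSingletonClass (gaussianReal 0 1) := nullSingletonClass_gaussianReal one_ne_zero
  have : NullSingletonClass ((gaussianReal 0 1).map id) := by rwa [Measure.map_id]
  have hcdf : ∀ X : ℝ, Tendsto
      (fun B : ℕ => P.real {ω |
        (batchGrad loss C w B (fun j => s j ω) z - m) / Real.sqrt (v / (B : ℝ)) ≤ X})
      atTop (𝓝 (cdf (gaussianReal 0 1) X)) := fun X => by
    rw [cdf_eq_real]
    simpa only [Measure.map_id] using tendsto_measureReal_le_of_tendstoInDistribution hclt X
  refine ⟨fun B ω => batchGrad_apply .., hind, hid, fun j => ⟨hLp j, ?_, ?_⟩, hclt, fun X => ?_,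
    fun ε hε => ?_⟩
  · rw [hm, (hidz j).integral_eq]
  · rw [hv, (hidz j).variance_eq]
  · convert hcdf X using 2
    rw [cdf_eq_real, gaussianReal_real_eq_integral _ one_ne_zero]
    simp [gaussianPDFReal, neg_div]
  · have hunif := tendstoUniformly_of_monotone_of_tendsto
      (F := fun (B : ℕ) X => P.real {ω |
        (batchGrad loss C w B (fun j => s j ω) z - m) / Real.sqrt (v / (B : ℝ)) ≤ X})
      (fun B x y hxy => measureReal_mono fun ω (hω : _ ≤ x) => hω.trans hxy)
      (fun _ _ => measureReal_nonneg) (fun _ _ => measureReal_le_one)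
      (monotone_cdf (gaussianReal 0 1)) (continuous_cdf_of_nullSingletonClass _)
      (tendsto_cdf_atBot _) (tendsto_cdf_atTop _) hcdf
    filter_upwards [Metric.tendstoUniformly_iff.1 hunif ε hε, eventually_gt_atTop 0]
      with B hB hB0 x
    have hσ : 0 < Real.sqrt (v / B) :=
      Real.sqrt_pos.2 (div_pos hvpos (by exact_mod_cast hB0))
    -- The evaluation point depends on `B`, so pointwise convergence would not suffice.
    have h := hB ((x - m) / Real.sqrt (v / B))
    rw [limitDensity_eq_gaussianPDFReal m hvpos hB0,
      ← gaussianReal_real_eq_integral _ (Real.toNNReal_pos.2 (pow_pos hσ 2)).ne',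
      gaussianReal_real_Iic_standardize m hσ, ← cdf_eq_real]
    rw [dist_comm, Real.dist_eq] at h
    simpa only [div_le_div_iff_of_pos_right hσ, sub_le_sub_iff_right] using h
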